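/- Let $n\ge 0$ be an integer and let $\mathbb{S}^n=\{y\in\mathbb{R}^{n+1}:\|y\|_2=1\}$ be the unit sphere, with its intrinsic metric $\rho$: $\rho(y,z)$ is the infimum of the Euclidean lengths of the continuous curves on $\mathbb{S}^n$ joining $y$ to $z$ (with $\rho=\infty$ between the two points of $\mathbb{S}^0$). Let $x\in\mathbb{S}^n$ and $0\le R<\pi$, and let $$C=\overline{B}(x,R)=\{y\in\mathbb{S}^n:\rho(x,y)\le R\}$$ be the closed ball of centre $x$ and radius $R$. Then every continuous map $f\colon C\to C$ has a fixed point. -/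

import Mathlib

/-- The unit sphere `𝕊ⁿ` of the Euclidean space `ℝⁿ⁺¹`. -/
abbrev UnitSphere (n : ℕ) : Type :=
  Metric.sphere (0 : EuclideanSpace ℝ (Fin (n + 1))) 1

/-- The intrinsic distance of `𝕊ⁿ`: the infimum of the lengths of the continuous curves on the
sphere that join `x` to `y`. The length of a curve is its total variation for the Euclidean
distance of `ℝⁿ⁺¹`. The value is `∞` if and only if no curve of finite length joins the two points,
which happens only for the two points of `𝕊⁰`. -/
noncomputable def sphereIntrinsicDist {n : ℕ} (x y : UnitSphere n) : ENNReal :=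
  ⨅ γ : Path x y, eVariationOn (fun t : unitInterval => γ t) Set.univ

/-- The closed ball of centre `x` and radius `R` for the intrinsic distance of `𝕊ⁿ`. -/
def sphereClosedBall {n : ℕ} (x : UnitSphere n) (R : ℝ) : Set (UnitSphere n) :=
  {y | sphereIntrinsicDist x y ≤ ENNReal.ofReal R}

/-! ### Brouwer's theorem in a finite-dimensional inner product space. -/

section Brouwer

open Set Metric MeasureTheory Polynomial

variable {E : Type*} [NormedAddCommGroup E] [InnerProductSpace ℝ E]

/-! A ball of radius `R < π` misses the antipode of its centre, and stereographic projection from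
there carries it onto a closed Euclidean ball, where Brouwer's theorem applies. The ball is a
spherical cap because intrinsic distance equals angle away from antipodes
(`mem_sphereClosedBall_iff_angle_le`).

Brouwer's theorem rests on `not_contDiffOn_retraction`. For a C¹ retraction `r` of the ball onto its
boundary and small `t > 0`, the map `x + t (r x - x)` permutes the open ball, so its Jacobian
integrates to the volume. The Jacobian is polynomial in `t`, so the integral is the volume at `t =
1` too; but there it is zero, since `r` takes values in the sphere. A C¹ map without fixed point
would give such a retraction, and continuous maps follow by approximation. -/

theorem exists_polynomial_eval_eq_det_one_add_smul [FiniteDimensional ℝ E] (A : E →L[ℝ] E) :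
    ∃ p : ℝ[X], p.natDegree ≤ Module.finrank ℝ E ∧
      ∀ t : ℝ, p.eval t = (ContinuousLinearMap.id ℝ E + t • A).det := by
  let b := Module.finBasis ℝ E
  let M := LinearMap.toMatrix b b (A : E →ₗ[ℝ] E)
  refine ⟨Matrix.det ((X : ℝ[X]) • M.map C + (1 : Matrix _ _ ℝ).map C), ?_, fun t => ?_⟩
  · simpa using natDegree_det_X_add_C_le M 1
  · have h1 : (ContinuousLinearMap.id ℝ E + t • A).det
        = (LinearMap.toMatrix b b (LinearMap.id + t • (A : E →ₗ[ℝ] E))).det := by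
      rw [LinearMap.det_toMatrix]; rfl
    rw [h1, ← coe_evalRingHom, RingHom.map_det]
    congr 1
    ext i j
    simp [M, Matrix.one_apply, add_comm]
    split_ifs <;> simp [mul_comm]

/-- Lagrange interpolation at dimension + 1 small nodes. The weights do not depend on `A`, so the
identity can be integrated over the ball. -/
theorem exists_det_one_add_smul_eq_sum [FiniteDimensional ℝ E] {ε : ℝ} (hε : 0 < ε) :
    ∃ (s : Finset ℝ) (L : ℝ → ℝ), (∀ t ∈ s, 0 < t ∧ t < ε) ∧ ∑ t ∈ s, L t = 1 ∧
      ∀ A : E →L[ℝ] E, (ContinuousLinearMap.id ℝ E + A).det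
        = ∑ t ∈ s, L t * (ContinuousLinearMap.id ℝ E + t • A).det := by
  obtain ⟨s, hs, hcard⟩ := (Ioo_infinite hε).exists_subset_card_eq (Module.finrank ℝ E + 1)
  have hinj : Set.InjOn (id : ℝ → ℝ) s := Function.injective_id.injOn
  have key : ∀ p : ℝ[X], p.natDegree ≤ Module.finrank ℝ E →
      p.eval 1 = ∑ t ∈ s, (Lagrange.basis s id t).eval 1 * p.eval t := by
    intro p hp
    have hdeg : p.degree < s.card := by
      rw [hcard]
      exact degree_le_natDegree.trans_lt (by exact_mod_cast Nat.lt_succ_of_le hp)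
    conv_lhs => rw [Lagrange.eq_interpolate hinj hdeg]
    simp [Lagrange.interpolate_apply, eval_finsetSum, mul_comm]
  refine ⟨s, fun t => (Lagrange.basis s id t).eval 1, fun t ht => hs ht, ?_, fun A => ?_⟩
  · have := key 1 (by simp)
    simpa using this.symm
  · obtain ⟨p, hp, hpe⟩ := exists_polynomial_eval_eq_det_one_add_smul A
    have := key p hp
    simp only [hpe] at this
    simpa using this

theorem exists_forall_norm_lt_det_one_add_pos [FiniteDimensional ℝ E] :
    ∃ δ > 0, ∀ A : E →L[ℝ] E, ‖A‖ < δ → 0 < (ContinuousLinearMap.id ℝ E + A).det := by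
  have hc : Continuous fun A : E →L[ℝ] E => (ContinuousLinearMap.id ℝ E + A).det :=
    ContinuousLinearMap.continuous_det.comp (by fun_prop)
  have h0 : (0 : ℝ) < (ContinuousLinearMap.id ℝ E + 0).det := by
    simp [ContinuousLinearMap.det]
  obtain ⟨δ, hδ, h⟩ := Metric.eventually_nhds_iff.1 (hc.continuousAt.eventually (lt_mem_nhds h0))
  exact ⟨δ, hδ, fun A hA => h (by simpa using hA)⟩

/-- A displacement that is Lipschitz on the closed unit ball and vanishes outside the open ball is
Lipschitz on the whole space. -/
theorem LipschitzOnWith.lipschitzWith_of_eq_zero_of_one_le_norm {h : E → E} {K : NNReal}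
    (hK : LipschitzOnWith K h (closedBall 0 1)) (h0 : ∀ x, 1 ≤ ‖x‖ → h x = 0) :
    LipschitzWith K h := by
  have key : ∀ x y : E, ‖x‖ ≤ 1 → 1 < ‖y‖ → dist (h x) (h y) ≤ K * dist x y := by
    intro x y hx hy
    have hcont : ContinuousOn (fun t : ℝ => ‖AffineMap.lineMap x y t‖) (Icc 0 1) := by
      simp only [AffineMap.lineMap_apply]; fun_prop
    -- The segment from `x` to `y` meets the unit sphere at a point where `h` vanishes.
    obtain ⟨t, ht, hz⟩ := intermediate_value_Icc (zero_le_one' ℝ) hcont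
      (show (1 : ℝ) ∈ Icc _ _ by simpa using ⟨hx, hy.le⟩)
    set z : E := AffineMap.lineMap x y t
    have hz : ‖z‖ = 1 := hz
    rw [h0 y hy.le, ← h0 z hz.ge]
    calc dist (h x) (h z) ≤ K * dist x z :=
          hK.dist_le_mul x (by simpa using hx) z (by simp [hz])
      _ ≤ K * dist x y := by
          gcongr
          rw [dist_left_lineMap, Real.norm_of_nonneg ht.1]
          exact mul_le_of_le_one_left dist_nonneg ht.2
  refine LipschitzWith.of_dist_le_mul fun x y => ?_
  rcases le_or_gt ‖x‖ 1 with hx | hx <;> rcases le_or_gt ‖y‖ 1 with hy | hy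
  · exact hK.dist_le_mul x (by simpa using hx) y (by simpa using hy)
  · exact key x y hx hy
  · rw [dist_comm, dist_comm x]; exact key y x hy hx
  · rw [h0 x hx.le, h0 y hy.le, dist_self]; positivity

/-- As `t • h` is a strict contraction, the map is injective, and a preimage of `y` is a fixed point
of `y - t • h x`. It lies in the open ball because `h` vanishes outside. -/
theorem image_ball_id_add_smul [CompleteSpace E] {h : E → E} {K : NNReal} (hK : LipschitzWith K h)
    (h0 : ∀ x, 1 ≤ ‖x‖ → h x = 0) (hb : ∀ x, ‖x‖ ≤ 1 → ‖x + h x‖ ≤ 1)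
    {t : ℝ} (ht0 : 0 < t) (ht1 : t < 1) (htK : t * K < 1) :
    InjOn (fun x => x + t • h x) (ball 0 1) ∧
      (fun x => x + t • h x) '' ball 0 1 = ball 0 1 := by
  have hlip : ∀ x y, ‖t • h x - t • h y‖ ≤ (t * K) * ‖x - y‖ := by
    intro x y
    rw [← smul_sub, norm_smul, Real.norm_of_nonneg ht0.le, mul_assoc]
    gcongr
    simpa [dist_eq_norm] using hK.dist_le_mul x y
  refine ⟨fun x _ y _ hxy => ?_, Subset.antisymm ?_ ?_⟩
  · by_contra hne
    have hpos : 0 < ‖x - y‖ := norm_pos_iff.2 (sub_ne_zero.2 hne)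
    have hxy' : x - y = t • h y - t • h x := by
      have hxy : x + t • h x = y + t • h y := hxy
      rw [sub_eq_sub_iff_add_eq_add, hxy, add_comm]
    have := hlip y x
    rw [← hxy', norm_sub_rev y x] at this
    nlinarith
  · rintro _ ⟨x, hx, rfl⟩
    rw [mem_ball_zero_iff] at hx ⊢
    have : x + t • h x = (1 - t) • x + t • (x + h x) := by module
    show ‖x + t • h x‖ < 1
    rw [this]
    calc ‖(1 - t) • x + t • (x + h x)‖ ≤ (1 - t) * ‖x‖ + t * ‖x + h x‖ := by
          refine (norm_add_le _ _).trans_eq ?_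
          rw [norm_smul, norm_smul, Real.norm_of_nonneg ht0.le,
            Real.norm_of_nonneg (sub_nonneg.2 ht1.le)]
      _ < 1 := by nlinarith [hb x hx.le]
  · intro y hy
    have hc : ContractingWith ⟨t * K, by positivity⟩ fun x => y - t • h x := by
      refine ⟨by exact_mod_cast htK, LipschitzWith.of_dist_le_mul fun a b => ?_⟩
      rw [dist_eq_norm, dist_eq_norm, sub_sub_sub_cancel_left, norm_sub_rev a b]
      exact hlip b a
    have hx := hc.fixedPoint_isFixedPt
    set x := hc.fixedPoint
    have hx : y - t • h x = x := hx
    refine ⟨x, ?_, by simp [← eq_sub_iff_add_eq, hx]⟩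
    rw [mem_ball_zero_iff] at hy ⊢
    by_contra! hx1
    rw [h0 x hx1] at hx
    simp at hx
    rw [hx] at hy
    linarith

/-- Differentiating `‖r‖ ^ 2 = 1` shows that the range of the derivative is orthogonal to `r x ≠ 0`.
-/
theorem det_fderiv_eq_zero_of_norm_eventually_eq_one [FiniteDimensional ℝ E] {r : E → E} {x : E}
    (hr : DifferentiableAt ℝ r x) (hn : ∀ᶠ y in nhds x, ‖r y‖ = 1) :
    (fderiv ℝ r x).det = 0 := by
  have hx : ‖r x‖ = 1 := hn.self_of_nhds
  have horth : ∀ v, inner ℝ (r x) (fderiv ℝ r x v) = 0 := by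
    intro v
    have h1 : HasFDerivAt (fun y => ‖r y‖ ^ 2) _ x := hr.hasFDerivAt.norm_sq
    have h2 : HasFDerivAt (fun y => ‖r y‖ ^ 2) (0 : E →L[ℝ] ℝ) x :=
      (hasFDerivAt_const (1 : ℝ) x).congr_of_eventuallyEq (hn.mono fun y hy => by simp [hy])
    simpa using congrArg (fun L : E →L[ℝ] ℝ => L v) (h1.unique h2)
  by_contra hdet
  have hsurj : Function.Surjective (fderiv ℝ r x) :=
    (LinearMap.equivOfDetNeZero (fderiv ℝ r x : E →ₗ[ℝ] E) hdet).surjective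
  obtain ⟨v, hv⟩ := hsurj (r x)
  have := horth v
  rw [hv, real_inner_self_eq_norm_sq, hx] at this
  norm_num at this

/-- There is no continuously differentiable retraction of the closed unit ball onto the sphere. -/
theorem not_contDiffOn_retraction [FiniteDimensional ℝ E] {r : E → E} {U : Set E}
    (hU : IsOpen U) (hBU : closedBall 0 1 ⊆ U) (hr : ContDiffOn ℝ 1 r U)
    (hn : ∀ x, ‖x‖ ≤ 1 → ‖r x‖ = 1) : ¬ ∀ x, ‖x‖ = 1 → r x = x := by
  intro hs
  let : MeasurableSpace E := borel E
  have : BorelSpace E := ⟨rfl⟩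
  have hdiff : ∀ x ∈ closedBall (0 : E) 1, HasFDerivAt r (fderiv ℝ r x) x := fun x hx =>
    ((hr.differentiableOn one_ne_zero).differentiableAt (hU.mem_nhds (hBU hx))).hasFDerivAt
  let A : E → E →L[ℝ] E := fun x => fderiv ℝ r x - ContinuousLinearMap.id ℝ E
  have hAc : ContinuousOn A (closedBall 0 1) :=
    ((hr.continuousOn_fderiv_of_isOpen hU le_rfl).mono hBU).sub continuousOn_const
  obtain ⟨M, hM⟩ := (isCompact_closedBall (0 : E) 1).exists_bound_of_continuousOn hAc
  have hM0 : 0 ≤ M := (norm_nonneg _).trans (hM 0 (by simp))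
  let h : E → E := fun x => if ‖x‖ < 1 then r x - x else 0
  have h0 : ∀ x, 1 ≤ ‖x‖ → h x = 0 := fun x hx => if_neg hx.not_gt
  have hin : EqOn h (fun x => r x - x) (closedBall 0 1) := by
    intro x hx
    rw [mem_closedBall_zero_iff] at hx
    by_cases hx1 : ‖x‖ < 1
    · exact if_pos hx1
    · simp [h, hx1, hs x (le_antisymm hx (not_lt.1 hx1))]
  have hlip : LipschitzWith M.toNNReal h := by
    refine LipschitzOnWith.lipschitzWith_of_eq_zero_of_one_le_norm ?_ h0
    have := (convex_closedBall (0 : E) 1).lipschitzOnWith_of_nnnorm_hasFDerivWithin_le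
      (f := fun x => r x - x) (f' := A) (C := M.toNNReal)
      (fun x hx => ((hdiff x hx).sub (hasFDerivAt_id x)).hasFDerivWithinAt)
      (fun x hx => by rw [← NNReal.coe_le_coe, coe_nnnorm, Real.coe_toNNReal _ hM0]; exact hM x hx)
    intro x hx y hy
    rw [hin hx, hin hy]
    exact this hx hy
  have hb : ∀ x, ‖x‖ ≤ 1 → ‖x + h x‖ ≤ 1 := by
    intro x hx
    rw [hin (mem_closedBall_zero_iff.2 hx)]
    simp [hn x hx]
  obtain ⟨δ, hδ, hdet⟩ := exists_forall_norm_lt_det_one_add_pos (E := E)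
  -- The three bounds give `t < 1`, the contraction condition `t * M < 1`, and `‖t • A x‖ < δ`,
  -- which makes the Jacobian positive.
  obtain ⟨s, L, hsε, hL1, hL⟩ := exists_det_one_add_smul_eq_sum (E := E)
    (ε := min 1 (min (1 / (M + 1)) (δ / (M + 1)))) (by positivity)
  have hint : ∀ t : ℝ, IntegrableOn (fun x => (ContinuousLinearMap.id ℝ E + t • A x).det)
      (ball 0 1) := fun t =>
    (ContinuousOn.integrableOn_compact (isCompact_closedBall (0 : E) 1)
      (ContinuousLinearMap.continuous_det.comp_continuousOn
        (continuousOn_const.add (hAc.const_smul t)))).mono_set ball_subset_closedBall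
  have hvol : ∀ t ∈ s, ∫ x in ball (0 : E) 1, (ContinuousLinearMap.id ℝ E + t • A x).det
      = volume.real (ball (0 : E) 1) := by
    intro t ht
    obtain ⟨ht0, htε⟩ := hsε t ht
    simp only [lt_min_iff, lt_div_iff₀ (by positivity : 0 < M + 1)] at htε
    obtain ⟨ht1, htM, htδ⟩ := htε
    obtain ⟨hinj, himg⟩ := image_ball_id_add_smul hlip h0 hb ht0 ht1
      (by rw [Real.coe_toNNReal _ hM0]; linarith)
    have hder : ∀ x ∈ ball (0 : E) 1, HasFDerivWithinAt (fun x => x + t • h x)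
        (ContinuousLinearMap.id ℝ E + t • A x) (ball 0 1) x := by
      intro x hx
      have h1 : HasFDerivAt (fun x => r x - x) (A x) x :=
        (hdiff x (ball_subset_closedBall hx)).sub (hasFDerivAt_id x)
      have h2 : HasFDerivAt h (A x) x := h1.congr_of_eventuallyEq <|
        Filter.eventuallyEq_of_mem (isOpen_ball.mem_nhds hx) (hin.mono ball_subset_closedBall)
      exact ((hasFDerivAt_id x).add (h2.const_smul t)).hasFDerivWithinAt
    have hcv := integral_image_eq_integral_abs_det_fderiv_smul volume measurableSet_ball hder hinj
      (fun _ => (1 : ℝ))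
    rw [himg] at hcv
    simp only [setIntegral_const, smul_eq_mul, mul_one] at hcv
    rw [hcv]
    refine setIntegral_congr_fun measurableSet_ball fun x hx => (abs_of_pos (hdet _ ?_)).symm
    rw [norm_smul, Real.norm_of_nonneg ht0.le]
    nlinarith [hM x (ball_subset_closedBall hx)]
  have hzero : ∫ x in ball (0 : E) 1, (ContinuousLinearMap.id ℝ E + A x).det = 0 := by
    refine setIntegral_eq_zero_of_forall_eq_zero fun x hx => ?_
    have : ContinuousLinearMap.id ℝ E + A x = fderiv ℝ r x := by simp [A]
    rw [this]
    refine det_fderiv_eq_zero_of_norm_eventually_eq_one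
      (hdiff x (ball_subset_closedBall hx)).differentiableAt ?_
    filter_upwards [isOpen_ball.mem_nhds hx] with y hy
    exact hn y (mem_ball_zero_iff.1 hy).le
  have hpos : 0 < volume.real (ball (0 : E) 1) :=
    ENNReal.toReal_pos (measure_ball_pos _ _ one_pos).ne' measure_ball_lt_top.ne
  have : ∫ x in ball (0 : E) 1, (ContinuousLinearMap.id ℝ E + A x).det
      = volume.real (ball (0 : E) 1) := by
    rw [integral_congr_ae (Filter.Eventually.of_forall fun x => hL (A x)),
      integral_finsetSum _ fun t _ => (hint t).const_mul _]
    simp_rw [integral_const_mul]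
    rw [Finset.sum_congr rfl fun t ht => by rw [hvol t ht], ← Finset.sum_mul, hL1, one_mul]
  linarith

/-- A continuously differentiable map of the closed unit ball into the open ball has a fixed
point. -/
theorem exists_fixedPoint_of_contDiff [FiniteDimensional ℝ E] {g : E → E} (hg : ContDiff ℝ 1 g)
    (hmaps : ∀ x, ‖x‖ ≤ 1 → ‖g x‖ < 1) : ∃ x, ‖x‖ ≤ 1 ∧ g x = x := by
  by_contra! hfix
  let u : E → E := fun x => x - g x
  -- `l x` is the larger root of `‖x + l • u x‖ ^ 2 = 1`, a quadratic in `l` with reduced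
  -- discriminant `D x`. It vanishes on the sphere because `inner ℝ x (u x) > 0` there.
  let D : E → ℝ := fun x => inner ℝ x (u x) ^ 2 + ‖u x‖ ^ 2 * (1 - ‖x‖ ^ 2)
  let l : E → ℝ := fun x => (√(D x) - inner ℝ x (u x)) / ‖u x‖ ^ 2
  have hu : ContDiff ℝ 1 u := contDiff_id.sub hg
  have hD : ContDiff ℝ 1 D :=
    ((contDiff_id.inner ℝ hu).pow 2).add
      ((hu.norm_sq ℝ).mul (contDiff_const.sub (contDiff_id.norm_sq ℝ)))
  have hu0 : ∀ x, ‖x‖ ≤ 1 → u x ≠ 0 := fun x hx h => hfix x hx (sub_eq_zero.1 h).symm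
  have hinner : ∀ x, ‖x‖ = 1 → 0 < inner ℝ x (u x) := by
    intro x hx
    have h1 : inner ℝ x (g x) ≤ ‖x‖ * ‖g x‖ := real_inner_le_norm _ _
    have h2 := hmaps x hx.le
    simp only [u, inner_sub_right, real_inner_self_eq_norm_sq, hx] at *
    linarith
  have hD0 : ∀ x, ‖x‖ ≤ 1 → 0 < D x := by
    intro x hx
    have hup : 0 < ‖u x‖ := norm_pos_iff.2 (hu0 x hx)
    rcases hx.lt_or_eq with hx1 | hx1
    · have : 0 < 1 - ‖x‖ ^ 2 := by nlinarith [norm_nonneg x]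
      simp only [D]; positivity
    · have := hinner x hx1
      simp only [D, hx1]; norm_num; positivity
  refine not_contDiffOn_retraction (r := fun x => x + l x • u x) (U := {x | 0 < D x ∧ u x ≠ 0})
    ((isOpen_lt continuous_const hD.continuous).inter (isOpen_ne_fun hu.continuous
      continuous_const)) (fun x hx => ?_) ?_ (fun x hx => ?_) (fun x hx => ?_)
  · rw [mem_closedBall_zero_iff] at hx
    exact ⟨hD0 x hx, hu0 x hx⟩
  · refine contDiffOn_id.add (ContDiffOn.smul ?_ hu.contDiffOn)
    refine ContDiffOn.div ((hD.contDiffOn.sqrt fun x hx => hx.1.ne').sub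
      (contDiff_id.inner ℝ hu).contDiffOn) (hu.norm_sq ℝ).contDiffOn fun x hx => ?_
    exact pow_ne_zero 2 (norm_ne_zero_iff.2 hx.2)
  · have hup : ‖u x‖ ^ 2 ≠ 0 := pow_ne_zero 2 (norm_ne_zero_iff.2 (hu0 x hx))
    have hsq : √(D x) ^ 2 = D x := Real.sq_sqrt (hD0 x hx).le
    have hl : l x * ‖u x‖ ^ 2 = √(D x) - inner ℝ x (u x) := div_mul_cancel₀ _ hup
    have key : ‖x + l x • u x‖ ^ 2 = 1 := by
      rw [norm_add_sq_real, inner_smul_right, norm_smul, mul_pow, Real.norm_eq_abs, sq_abs]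
      refine mul_right_cancel₀ hup ?_
      have hs : √(D x) = l x * ‖u x‖ ^ 2 + inner ℝ x (u x) := by linarith
      rw [hs] at hsq
      simp only [D] at hsq
      linear_combination hsq
    exact (sq_eq_sq₀ (norm_nonneg _) zero_le_one).1 (by simpa using key)
  · have : √(D x) = inner ℝ x (u x) := by
      simp only [D, hx]
      norm_num
      exact Real.sqrt_sq (hinner x hx).le
    simp [l, this]

/-- Brouwer's theorem for the closed unit ball. -/
theorem exists_fixedPoint_closedBall_one [FiniteDimensional ℝ E]
    {f : closedBall (0 : E) 1 → closedBall (0 : E) 1} (hf : Continuous f) : ∃ x, f x = x := by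
  by_contra! hfix
  have hcomp : CompactSpace (closedBall (0 : E) 1) :=
    isCompact_iff_compactSpace.1 (isCompact_closedBall 0 1)
  obtain ⟨x₀, -, hx₀⟩ := isCompact_univ.exists_isMinOn ⟨⟨0, by simp⟩, mem_univ _⟩
    (f := fun x => dist (f x) x) (by fun_prop)
  set δ := dist (f x₀) x₀
  have hδ : 0 < δ := dist_pos.2 (hfix x₀)
  have hδx : ∀ x, δ ≤ dist (f x) x := fun x => hx₀ (mem_univ x)
  let p : E → closedBall (0 : E) 1 := fun x => ⟨(max 1 ‖x‖)⁻¹ • x, by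
    rw [mem_closedBall_zero_iff, norm_smul, norm_inv, Real.norm_of_nonneg (by positivity),
      inv_mul_le_iff₀ (by positivity), mul_one]
    exact le_max_right _ _⟩
  have hp : Continuous p := by
    refine Continuous.subtype_mk (Continuous.smul (Continuous.inv₀ (by fun_prop) fun x => ?_)
      continuous_id) _
    positivity
  have hpid : ∀ x (hx : ‖x‖ ≤ 1), p x = ⟨x, mem_closedBall_zero_iff.2 hx⟩ := by
    intro x hx
    simp [p, hx]
  -- The fixed point of the rescaled approximation satisfies `dist (g x) x ≤ ε`, so `f` moves it by
  -- less than `2 * ε < δ`.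
  let ε := δ / 4
  have hε : 0 < ε := by positivity
  obtain ⟨g, hg, hgf, -⟩ := (show Continuous fun x => (f (p x) : E) by
    fun_prop).exists_contDiff_approx 1 (ε := fun _ => ε) continuous_const fun _ => hε
  have hnf : ∀ x, ‖(f (p x) : E)‖ ≤ 1 := fun x => mem_closedBall_zero_iff.1 (f (p x)).2
  have hng : ∀ x, ‖g x‖ < 1 + ε := by
    intro x
    have := hgf x
    rw [dist_eq_norm] at this
    calc ‖g x‖ = ‖(f (p x) : E) + (g x - f (p x))‖ := by simp
      _ ≤ _ := norm_add_le _ _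
      _ < 1 + ε := by linarith [hnf x]
  obtain ⟨x, hx, hgx⟩ := exists_fixedPoint_of_contDiff (g := fun x => (1 + ε)⁻¹ • g x)
    (hg.const_smul _) fun x _ => by
      rw [norm_smul, norm_inv, Real.norm_of_nonneg (by positivity), inv_mul_lt_iff₀ (by positivity),
        mul_one]
      exact hng x
  have hgx' : g x = (1 + ε) • x := by
    conv_rhs => rw [← hgx, smul_inv_smul₀ (by positivity)]
  have h1 := hgf x
  have h2 := hδx ⟨x, mem_closedBall_zero_iff.2 hx⟩
  rw [Subtype.dist_eq, ← hpid x hx] at h2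
  have h3 : dist (g x) x ≤ ε := by
    rw [hgx', dist_eq_norm, add_smul, one_smul, add_sub_cancel_left, norm_smul,
      Real.norm_of_nonneg hε.le]
    exact mul_le_of_le_one_right hε.le hx
  have h4 : dist (f (p x) : E) (p x) ≤ dist (g x) (f (p x)) + dist (g x) x := by
    rw [dist_comm (g x), hpid x hx]; exact dist_triangle _ _ _
  have : ε = δ / 4 := rfl
  linarith

/-- Brouwer's theorem for a closed ball. -/
theorem exists_fixedPoint_closedBall [FiniteDimensional ℝ E] {R : ℝ} (hR : 0 ≤ R)
    {f : closedBall (0 : E) R → closedBall (0 : E) R} (hf : Continuous f) : ∃ x, f x = x := by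
  rcases hR.eq_or_lt with rfl | hR
  · have hsub : Subsingleton (closedBall (0 : E) 0) := by
      rw [closedBall_zero]; infer_instance
    exact ⟨⟨0, by simp⟩, Subsingleton.elim _ _⟩
  · let φ : closedBall (0 : E) 1 → closedBall (0 : E) R := fun x => ⟨R • (x : E), by
      have := mem_closedBall_zero_iff.1 x.2
      rw [mem_closedBall_zero_iff, norm_smul, Real.norm_of_nonneg hR.le]
      exact mul_le_of_le_one_right hR.le this⟩
    let ψ : closedBall (0 : E) R → closedBall (0 : E) 1 := fun x => ⟨R⁻¹ • (x : E), by
      have := mem_closedBall_zero_iff.1 x.2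
      rw [mem_closedBall_zero_iff, norm_smul, norm_inv, Real.norm_of_nonneg hR.le]
      rwa [inv_mul_le_iff₀ hR, mul_one]⟩
    have hφ : Continuous φ := by fun_prop
    have hψ : Continuous ψ := by fun_prop
    obtain ⟨x, hx⟩ := exists_fixedPoint_closedBall_one (hψ.comp (hf.comp hφ))
    refine ⟨φ x, ?_⟩
    have : φ (ψ (f (φ x))) = φ x := congrArg φ hx
    rwa [show φ (ψ (f (φ x))) = f (φ x) from Subtype.ext (smul_inv_smul₀ hR.ne' _)] at this

end Brouwer

/-! ### Intrinsic distance and angle on the sphere. -/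

section SphereDistance

open InnerProductGeometry Real Set

variable {V : Type*} [NormedAddCommGroup V] [InnerProductSpace ℝ V]

theorem cos_angle_of_norm_eq_one {x y : V} (hx : ‖x‖ = 1) (hy : ‖y‖ = 1) :
    cos (angle x y) = inner ℝ x y := by
  rw [cos_angle, hx, hy]; simp

/-- The chord is `2 * sin (θ / 2)`. The cubic error is negligible along fine subdivisions of a
curve. -/
theorem angle_le_dist_add_dist_pow {x y : V} (hx : ‖x‖ = 1) (hy : ‖y‖ = 1) :
    angle x y ≤ dist x y + dist x y ^ 3 := by
  set θ := angle x y
  have hθ0 : 0 ≤ θ := angle_nonneg x y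
  have hθπ : θ ≤ π := angle_le_pi x y
  have hsin0 : 0 ≤ sin (θ / 2) := sin_nonneg_of_nonneg_of_le_pi (by linarith) (by linarith)
  have hdist : dist x y = 2 * sin (θ / 2) := by
    have h1 : dist x y ^ 2 = (2 * sin (θ / 2)) ^ 2 := by
      rw [dist_eq_norm, norm_sub_sq_real, ← cos_angle_of_norm_eq_one hx hy, hx, hy, mul_pow,
        sin_sq_eq_half_sub, show 2 * (θ / 2) = θ by ring]
      ring
    exact (sq_eq_sq₀ dist_nonneg (by positivity)).1 h1
  rcases hθ0.eq_or_lt with h | hθ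
  · rw [← h]; positivity
  have h1 := mul_le_sin (x := θ / 2) (by positivity) (by linarith)
  have h2 := sin_gt_sub_cube (x := θ / 2) (by positivity)
  have h3 : θ / 2 ≤ 2 * sin (θ / 2) := by
    have : (1 : ℝ) / 2 ≤ 2 / π := by
      rw [div_le_div_iff₀ two_pos pi_pos]; linarith [pi_le_four]
    nlinarith
  rw [hdist]
  have h4 : (θ / 2) ^ 3 ≤ (2 * sin (θ / 2)) ^ 3 := by gcongr
  have h5 : 0 ≤ (2 * sin (θ / 2)) ^ 3 := by positivity
  linarith

theorem angle_le_sum_angle (u : ℕ → V) (hu : ∀ i, ‖u i‖ = 1) (n : ℕ) :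
    angle (u 0) (u n) ≤ ∑ i ∈ Finset.range n, angle (u i) (u (i + 1)) := by
  induction n with
  | zero =>
    have : u 0 ≠ 0 := fun h => by simpa [h] using hu 0
    simp [angle_self this]
  | succ n ih =>
    rw [Finset.sum_range_succ]
    exact (angle_le_angle_add_angle _ (u n) _).trans (by gcongr)

/-- Along an inscribed polygon with sides at most `δ`, angles exceed chords by a factor of at most
`1 + δ ^ 2`; then `δ → 0`. -/
theorem ofReal_angle_le_eVariationOn {n : ℕ} {x y : UnitSphere n} (γ : Path x y) :
    ENNReal.ofReal (angle (x : EuclideanSpace ℝ (Fin (n + 1))) y)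
      ≤ eVariationOn (fun t : unitInterval => γ t) univ := by
  rcases eq_or_ne (eVariationOn (fun t : unitInterval => γ t) univ) ⊤ with htop | htop
  · rw [htop]; exact le_top
  set W := (eVariationOn (fun t : unitInterval => γ t) univ).toReal with hW
  have hW0 : 0 ≤ W := ENNReal.toReal_nonneg
  have hnorm : ∀ z : UnitSphere n, ‖(z : EuclideanSpace ℝ (Fin (n + 1)))‖ = 1 := fun z =>
    mem_sphere_zero_iff_norm.1 z.2
  have key : ∀ δ : ℝ, 0 < δ →
      angle (x : EuclideanSpace ℝ (Fin (n + 1))) y ≤ (1 + δ ^ 2) * W := by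
    intro δ hδ
    obtain ⟨t, ht0, htm, ⟨N, hN⟩, hts⟩ := exists_monotone_Icc_subset_open_cover_unitInterval
      (c := fun s : unitInterval => γ ⁻¹' Metric.ball (γ s) (δ / 2))
      (fun s => Metric.isOpen_ball.preimage γ.continuous)
      (fun s _ => mem_iUnion.2 ⟨s, Metric.mem_ball_self (by positivity)⟩)
    have hd : ∀ i, dist (γ (t i)) (γ (t (i + 1))) ≤ δ := by
      intro i
      obtain ⟨s, hs⟩ := hts i
      have h1 := hs (left_mem_Icc.2 (htm i.le_succ))
      have h2 := hs (right_mem_Icc.2 (htm i.le_succ))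
      rw [mem_preimage, Metric.mem_ball] at h1 h2
      linarith [dist_triangle_right (γ (t i)) (γ (t (i + 1))) (γ s)]
    have hsum : ∑ i ∈ Finset.range N, dist (γ (t i)) (γ (t (i + 1))) ≤ W := by
      have h1 := eVariationOn.sum_le (f := fun t : unitInterval => γ t) (n := N) htm
        (fun i => mem_univ (t i))
      rw [hW, ← ENNReal.ofReal_le_iff_le_toReal htop,
        ENNReal.ofReal_sum_of_nonneg fun _ _ => dist_nonneg]
      refine le_trans (Finset.sum_le_sum fun i _ => ?_) h1
      rw [edist_comm, edist_dist]
    have h1 := angle_le_sum_angle (fun i => (γ (t i) : EuclideanSpace ℝ (Fin (n + 1))))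
      (fun i => hnorm _) N
    simp only [ht0, hN N le_rfl, γ.source, γ.target] at h1
    calc _ ≤ _ := h1
      _ ≤ ∑ i ∈ Finset.range N, (1 + δ ^ 2) * dist (γ (t i)) (γ (t (i + 1))) := by
          refine Finset.sum_le_sum fun i _ => (angle_le_dist_add_dist_pow (hnorm _)
            (hnorm _)).trans ?_
          rw [← Subtype.dist_eq]
          have := hd i
          set d := dist (γ (t i)) (γ (t (i + 1)))
          have hd0 : 0 ≤ d := dist_nonneg
          have : d ^ 2 ≤ δ ^ 2 := by gcongr
          nlinarith
      _ ≤ (1 + δ ^ 2) * W := by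
          rw [← Finset.mul_sum]; gcongr
  rw [ENNReal.ofReal_le_iff_le_toReal htop, ← hW]
  have hlim : Filter.Tendsto (fun δ : ℝ => (1 + δ ^ 2) * W) (nhdsWithin 0 (Ioi 0)) (nhds W) := by
    have : Continuous fun δ : ℝ => (1 + δ ^ 2) * W := by fun_prop
    simpa using (this.tendsto 0).mono_left nhdsWithin_le_nhds
  exact ge_of_tendsto hlim (by filter_upwards [self_mem_nhdsWithin] with δ hδ using key δ hδ)

theorem ofReal_angle_le_sphereIntrinsicDist {n : ℕ} (x y : UnitSphere n) :
    ENNReal.ofReal (angle (x : EuclideanSpace ℝ (Fin (n + 1))) y) ≤ sphereIntrinsicDist x y :=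
  le_iInf ofReal_angle_le_eVariationOn

theorem norm_sq_cos_smul_add_sin_smul_sub {x u : V} (hx : ‖x‖ = 1) (hu : ‖u‖ = 1)
    (hxu : inner ℝ x u = 0) (a b : ℝ) :
    ‖(cos a • x + sin a • u) - (cos b • x + sin b • u)‖ ^ 2 = 2 - 2 * cos (a - b) := by
  have : (cos a • x + sin a • u) - (cos b • x + sin b • u)
      = (cos a - cos b) • x + (sin a - sin b) • u := by module
  rw [this, norm_add_sq_real, norm_smul, norm_smul, inner_smul_left, inner_smul_right, hxu, hx, hu,
    mul_one, mul_one, norm_eq_abs, norm_eq_abs, sq_abs, sq_abs, cos_sub]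
  simp only [mul_zero, add_zero]
  linear_combination cos_sq_add_sin_sq a + cos_sq_add_sin_sq b

/-- The great circle arc from `x` to `y`, run at speed `θ`, has length at most `θ`. Antipodes are
excluded: they do not determine an arc, and on `𝕊⁰` there is none. -/
theorem sphereIntrinsicDist_le_ofReal_angle {n : ℕ} (x y : UnitSphere n)
    (h : angle (x : EuclideanSpace ℝ (Fin (n + 1))) y < π) :
    sphereIntrinsicDist x y ≤ ENNReal.ofReal (angle (x : EuclideanSpace ℝ (Fin (n + 1))) y) := by
  have hx : ‖(x : EuclideanSpace ℝ (Fin (n + 1)))‖ = 1 := mem_sphere_zero_iff_norm.1 x.2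
  have hy : ‖(y : EuclideanSpace ℝ (Fin (n + 1)))‖ = 1 := mem_sphere_zero_iff_norm.1 y.2
  have hcos := cos_angle_of_norm_eq_one hx hy
  set θ := angle (x : EuclideanSpace ℝ (Fin (n + 1))) y
  have hθ0 : 0 ≤ θ := angle_nonneg _ _
  rcases hθ0.eq_or_lt with h0 | h0
  · have hxy : x = y := by
      rw [← h0, cos_zero] at hcos
      exact Subtype.ext ((inner_eq_one_iff_of_norm_eq_one hx hy).1 hcos.symm)
    subst hxy
    refine iInf_le_of_le (Path.refl x) ?_
    rw [eVariationOn.constant_on]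
    · exact zero_le
    · rintro _ ⟨_, _, rfl⟩ _ ⟨_, _, rfl⟩; rfl
  have hsin : 0 < sin θ := sin_pos_of_pos_of_lt_pi h0 h
  -- The unit tangent vector at `x` pointing towards `y`.
  obtain ⟨u, hu⟩ : ∃ u : EuclideanSpace ℝ (Fin (n + 1)),
      u = (sin θ)⁻¹ • ((y : EuclideanSpace ℝ (Fin (n + 1))) - cos θ • (x : _)) := ⟨_, rfl⟩
  have hyu : cos θ • (x : EuclideanSpace ℝ (Fin (n + 1))) + sin θ • u = y := by
    rw [hu, smul_inv_smul₀ hsin.ne']; simp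
  have hxu : inner ℝ (x : EuclideanSpace ℝ (Fin (n + 1))) u = 0 := by
    rw [hu, inner_smul_right, inner_sub_right, inner_smul_right, real_inner_self_eq_norm_sq, hx,
      hcos]
    ring
  have hu1 : ‖u‖ = 1 := by
    have h1 : ‖cos θ • (x : EuclideanSpace ℝ (Fin (n + 1))) + sin θ • u‖ ^ 2 = 1 := by
      rw [hyu, hy]; norm_num
    rw [norm_add_sq_real, norm_smul, norm_smul, inner_smul_left, inner_smul_right, hxu, hx,
      mul_pow, mul_pow, norm_eq_abs, norm_eq_abs, sq_abs, sq_abs] at h1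
    have h2 : sin θ ^ 2 * (‖u‖ ^ 2 - 1) = 0 := by
      linear_combination h1 - cos_sq_add_sin_sq θ
    rcases mul_eq_zero.1 h2 with h3 | h3
    · exact absurd h3 (by positivity)
    · exact (sq_eq_sq₀ (norm_nonneg _) zero_le_one).1 (by linarith)
  let g : ℝ → UnitSphere n := fun t =>
    ⟨cos (t * θ) • (x : EuclideanSpace ℝ (Fin (n + 1))) + sin (t * θ) • u, by
      rw [mem_sphere_zero_iff_norm]
      refine (sq_eq_sq₀ (norm_nonneg _) zero_le_one).1 ?_
      rw [norm_add_sq_real, norm_smul, norm_smul, inner_smul_left, inner_smul_right, hxu, hx, hu1,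
        mul_one, mul_one, norm_eq_abs, norm_eq_abs, sq_abs, sq_abs]
      simp⟩
  have hg : LipschitzWith θ.toNNReal g := by
    refine LipschitzWith.of_dist_le_mul fun s t => ?_
    rw [Subtype.dist_eq, dist_eq_norm, dist_eq, coe_toNNReal θ hθ0]
    refine abs_le_of_sq_le_sq' ?_ (by positivity) |>.2
    rw [norm_sq_cos_smul_add_sin_smul_sub hx hu1 hxu, mul_pow, sq_abs]
    have := one_sub_sq_div_two_le_cos (x := s * θ - t * θ)
    nlinarith
  let γ : Path x y :=
    { toFun := fun t => g t
      continuous_toFun := hg.continuous.comp continuous_subtype_val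
      source' := Subtype.ext (by simp [g])
      target' := Subtype.ext (by simpa [g] using hyu) }
  refine iInf_le_of_le γ ?_
  have h1 : eVariationOn (g ∘ ((↑) : unitInterval → ℝ)) univ
      ≤ (θ.toNNReal : ENNReal) * eVariationOn ((↑) : unitInterval → ℝ) univ :=
    hg.lipschitzOnWith.comp_eVariationOn_le (mapsTo_univ _ _)
  have h2 : eVariationOn ((↑) : unitInterval → ℝ) univ ≤ 1 := by
    have := (Subtype.mono_coe (fun t : ℝ => t ∈ unitInterval)).monotoneOn univ |>.eVariationOn_eq
      (mem_univ (0 : unitInterval)) (mem_univ (1 : unitInterval))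
    have hI : univ ∩ Icc (0 : unitInterval) 1 = univ := by
      exact eq_univ_of_forall fun t => ⟨mem_univ t, unitInterval.nonneg t, unitInterval.le_one t⟩
    rw [hI] at this
    simp [this]
  calc _ ≤ _ := h1
    _ ≤ (θ.toNNReal : ENNReal) * 1 := by gcongr
    _ = ENNReal.ofReal θ := mul_one _

theorem mem_sphereClosedBall_iff_angle_le {n : ℕ} {x y : UnitSphere n} {R : ℝ} (hR : 0 ≤ R)
    (hRpi : R < π) :
    y ∈ sphereClosedBall x R ↔ angle (x : EuclideanSpace ℝ (Fin (n + 1))) y ≤ R := by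
  constructor
  · intro h
    exact (ENNReal.ofReal_le_ofReal_iff hR).1 ((ofReal_angle_le_sphereIntrinsicDist x y).trans h)
  · intro h
    exact (sphereIntrinsicDist_le_ofReal_angle x y (h.trans_lt hRpi)).trans
      (ENNReal.ofReal_le_ofReal h)

/-! ### Stereographic projection and transfer of the fixed point. -/

theorem norm_stereographic_sq {v : V} (hv : ‖v‖ = 1) (y : Metric.sphere (0 : V) 1)
    (hy : inner ℝ v (y : V) ≠ 1) :
    ‖stereographic hv y‖ ^ 2 = 4 * (1 + inner ℝ v (y : V)) / (1 - inner ℝ v (y : V)) := by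
  have hy1 : ‖(y : V)‖ = 1 := mem_sphere_zero_iff_norm.1 y.2
  have h1 : ‖((ℝ ∙ v)ᗮ.orthogonalProjectionOnto (y : V))‖ ^ 2 = 1 - inner ℝ v (y : V) ^ 2 := by
    have h2 : (((ℝ ∙ v)ᗮ.orthogonalProjectionOnto (y : V)) : V) = y - (inner ℝ v (y : V)) • v := by
      have := (ℝ ∙ v).starProjection_add_starProjection_orthogonal (y : V)
      rw [Submodule.starProjection_unit_singleton ℝ hv] at this
      exact eq_sub_of_add_eq' this
    rw [← Submodule.norm_coe, h2, norm_sub_sq_real, inner_smul_right, norm_smul, mul_pow, hv, hy1,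
      norm_eq_abs, sq_abs, real_inner_comm]
    ring
  have hne : 1 - inner ℝ v (y : V) ≠ 0 := sub_ne_zero.2 hy.symm
  rw [stereographic_apply, norm_smul, mul_pow, h1, norm_eq_abs, sq_abs]
  field_simp
  ring

/-- Closed balls of radius less than `π` are the preimages of the closed balls centred at the
origin under the stereographic projection from the antipode of the centre. -/
theorem exists_mem_sphereClosedBall_iff_norm_stereographic_le {n : ℕ} (x : UnitSphere n) {R : ℝ}
    (hR : 0 ≤ R) (hRpi : R < π)
    (hv : ‖-(x : EuclideanSpace ℝ (Fin (n + 1)))‖ = 1) :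
    sphereClosedBall x R ⊆ (stereographic hv).source ∧ ∃ r, 0 ≤ r ∧
      ∀ y ∈ (stereographic hv).source, y ∈ sphereClosedBall x R ↔ ‖stereographic hv y‖ ≤ r := by
  have hnorm : ∀ z : UnitSphere n, ‖(z : EuclideanSpace ℝ (Fin (n + 1)))‖ = 1 := fun z =>
    mem_sphere_zero_iff_norm.1 z.2
  have hcosR : -1 < cos R := by
    rw [← cos_pi]; exact cos_lt_cos_of_nonneg_of_le_pi hR le_rfl hRpi
  have hmem : ∀ y, y ∈ sphereClosedBall x R ↔
      cos R ≤ inner ℝ (x : EuclideanSpace ℝ (Fin (n + 1))) y := by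
    intro y
    rw [mem_sphereClosedBall_iff_angle_le hR hRpi, ← cos_angle_of_norm_eq_one (hnorm x) (hnorm y)]
    exact (strictAntiOn_cos.le_iff_ge ⟨hR, hRpi.le⟩ ⟨angle_nonneg _ _, angle_le_pi _ _⟩).symm
  have hsrc : ∀ y, y ∈ (stereographic hv).source ↔
      inner ℝ (x : EuclideanSpace ℝ (Fin (n + 1))) y ≠ -1 := by
    intro y
    rw [stereographic_source, mem_compl_singleton_iff, ne_eq, ne_eq, not_iff_not, Subtype.ext_iff,
      eq_comm, ← inner_eq_one_iff_of_norm_eq_one (𝕜 := ℝ) hv (hnorm y), inner_neg_left,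
      neg_eq_iff_eq_neg]
  -- The radius is the norm of the projection at angle `R` from `x`; `R < π` keeps `1 + cos R`
  -- positive.
  refine ⟨fun y hy => (hsrc y).2 ?_, √(4 * (1 - cos R) / (1 + cos R)), sqrt_nonneg _, ?_⟩
  · linarith [(hmem y).1 hy]
  · intro y hy
    have hy' := (hsrc y).1 hy
    have hge : -1 < inner ℝ (x : EuclideanSpace ℝ (Fin (n + 1))) y := by
      refine lt_of_le_of_ne ?_ hy'.symm
      have := (abs_le.1 (abs_real_inner_le_norm (x : EuclideanSpace ℝ (Fin (n + 1))) y)).1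
      rwa [hnorm x, hnorm y, mul_one] at this
    have hq : 0 ≤ 4 * (1 - cos R) / (1 + cos R) :=
      div_nonneg (by linarith [cos_le_one R]) (by linarith)
    rw [hmem, le_sqrt (norm_nonneg _) hq, norm_stereographic_sq hv y (by
      rw [inner_neg_left]; contrapose! hy'; linarith), inner_neg_left, ← sub_eq_add_neg,
      sub_neg_eq_add, div_le_div_iff₀ (by linarith) (by linarith)]
    constructor <;> intro h <;> nlinarith

/-- Brouwer's theorem for a set that a chart onto the whole model space maps onto a closed ball. -/
theorem OpenPartialHomeomorph.exists_fixedPoint {X : Type*} [TopologicalSpace X]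
    [FiniteDimensional ℝ V] (e : OpenPartialHomeomorph X V) (htgt : ∀ w, w ∈ e.target) {s : Set X}
    (hs : s ⊆ e.source) {r : ℝ} (hr : 0 ≤ r) (hiff : ∀ y ∈ e.source, y ∈ s ↔ ‖e y‖ ≤ r)
    {f : s → s} (hf : Continuous f) : ∃ z, f z = z := by
  let φ : s → Metric.closedBall (0 : V) r := fun y =>
    ⟨e y, mem_closedBall_zero_iff.2 ((hiff y (hs y.2)).1 y.2)⟩
  let ψ : Metric.closedBall (0 : V) r → s := fun w =>
    ⟨e.symm w, (hiff _ (e.map_target (htgt w))).2 (by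
      rw [e.right_inv (htgt w)]; exact mem_closedBall_zero_iff.1 w.2)⟩
  have hφ : Continuous φ := ((e.continuousOn.mono hs).domRestrict).subtype_mk _
  have hψ : Continuous ψ :=
    (e.symm.continuousOn.comp_continuous continuous_subtype_val fun w => htgt w).subtype_mk _
  obtain ⟨w, hw⟩ := exists_fixedPoint_closedBall hr (hφ.comp (hf.comp hψ))
  refine ⟨ψ w, ?_⟩
  have h : ψ (φ (f (ψ w))) = ψ w := congrArg ψ hw
  rwa [show ψ (φ (f (ψ w))) = f (ψ w) from Subtype.ext (e.left_inv (hs (f (ψ w)).2))] at h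

end SphereDistance

theorem mainTheorem6 (n : ℕ) (x : UnitSphere n) (R : ℝ) (hR : 0 ≤ R) (hRpi : R < Real.pi)
    (f : sphereClosedBall x R → sphereClosedBall x R) (hf : Continuous f) :
    ∃ z : sphereClosedBall x R, f z = z := by
  have hv : ‖-(x : EuclideanSpace ℝ (Fin (n + 1)))‖ = 1 := by
    rw [norm_neg]; exact mem_sphere_zero_iff_norm.1 x.2
  obtain ⟨hsub, r, hr, hiff⟩ := exists_mem_sphereClosedBall_iff_norm_stereographic_le x hR hRpi hv
  exact (stereographic hv).exists_fixedPoint (fun w => by simp) hsub hr hiff hf
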